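/- Let $d \ge 2$ and $-1 \le \gamma \le 1$, let $V$ be the swap operator on $\mathbb{C}^d \otimes \mathbb{C}^d$, and let $\rho_W(\gamma) = \frac{I + \gamma V}{\operatorname{tr}(I + \gamma V)}$ be the Werner state on the system $AB$, where $A$ and $B$ have dimension $d$. For a completely positive (not necessarily trace-preserving) linear map $\Lambda$ from operators on $AB$ to operators on a two-qubit system $ab$ with $\operatorname{tr}\Lambda(\rho) \ne 0$, put $$F(\rho, \Lambda) = \frac{\operatorname{tr}(\Lambda(\rho)\,\Phi^+)}{\operatorname{tr}\Lambda(\rho)}, \qquad \Phi^+ = |\phi_+\rangle\langle\phi_+|, \qquad |\phi_+\rangle = \tfrac{1}{\sqrt2}(|00\rangle + |11\rangle).$$ The Choi–Jamiołkowski state of $\Lambda$ is the (not necessarily normalized) operator $\sigma_{A'B'ab} = (\mathrm{id} \otimes \Lambda)(\Phi^+_{A'A} \otimes \Phi^+_{B'B})$, where $\Phi^+_{A'A}$ and $\Phi^+_{B'B}$ denote the maximally entangled states $|\phi\rangle\langle\phi|$, $|\phi\rangle = \frac{1}{\sqrt d}\sum_{i=0}^{d-1} |ii\rangle$. The map $\Lambda$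 is called $1$-extendible if this operator, written $\sigma_{AaBb}$ (with $A'B'$ renamed $AB$), has an extension on Bob's site, i.e. if there is a positive semidefinite operator $\tau$ on $Aa \otimes B_0b_0 \otimes B_1b_1$ (where $B_ib_i$ are copies of $Bb$) whose reductions satisfy $\tau_{AaB_0b_0} = \tau_{AaB_1b_1} = \sigma_{AaBb}$. Then the maximum of $F(\rho_W(\gamma), \Lambda)$ over all $1$-extendible maps $\Lambda$ with $\operatorname{tr}\Lambda(\rho_W(\gamma)) \ne 0$ is attained and equals $$\frac12 + \frac12\sqrt{\frac{1+2\gamma^2}{4-\gamma^2}},$$ independently of $d$. In particular, in the boundary cases $\gamma = \pm 1$ the fidelity $1$ is attained. -/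

import Mathlib

open scoped ComplexOrder MatrixOrder Matrix.Norms.L2Operator CStarAlgebra

namespace ExtendibleMaps

noncomputable section

/-- The unit vector `|φ₊⟩ = n^{-1/2} ∑ᵢ |ii⟩` of `ℂⁿ ⊗ ℂⁿ`, where `n` is the size of `ι`. -/
def maxEntVec (ι : Type*) [Fintype ι] [DecidableEq ι] : ι × ι → ℂ :=
  fun x => if x.1 = x.2 then (((Real.sqrt (Fintype.card ι))⁻¹ : ℝ) : ℂ) else 0

/-- The maximally entangled state `Φ⁺ = |φ₊⟩⟨φ₊|`. -/
def maxEnt (ι : Type*) [Fintype ι] [DecidableEq ι] : Matrix (ι × ι) (ι × ι) ℂ :=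
  Matrix.vecMulVec (maxEntVec ι) (star (maxEntVec ι))

/-- `(id ⊗ Λ)(X)` for a linear map `Λ` from operators on `I` to operators on `O` and an operator
`X` on `R ⊗ I`: the map `Λ` is applied to each block of `X`. -/
def idTensor {R I O : Type*} (Λ : Matrix I I ℂ →ₗ[ℂ] Matrix O O ℂ)
    (X : Matrix (R × I) (R × I) ℂ) : Matrix (R × O) (R × O) ℂ :=
  Matrix.of fun p q => Λ (Matrix.of fun x y => X (p.1, x) (q.1, y)) p.2 q.2

/-- The operator `Φ⁺_{A'A} ⊗ Φ⁺_{B'B}`, as an operator on `(A'B') ⊗ (AB)`. -/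
def maxEntPair (A B : Type*) [Fintype A] [Fintype B] [DecidableEq A] [DecidableEq B] :
    Matrix ((A × B) × (A × B)) ((A × B) × (A × B)) ℂ :=
  Matrix.of fun p q =>
    maxEnt A (p.1.1, p.2.1) (q.1.1, q.2.1) * maxEnt B (p.1.2, p.2.2) (q.1.2, q.2.2)

/-- The Choi-Jamiolkowski operator `σ_{A'B'ab} = (id ⊗ Λ)(Φ⁺_{A'A} ⊗ Φ⁺_{B'B})` of a linear map `Λ`
from operators on `AB` to operators on `ab`. -/
def choi {A B a b : Type*} [Fintype A] [Fintype B] [DecidableEq A] [DecidableEq B]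
    (Λ : Matrix (A × B) (A × B) ℂ →ₗ[ℂ] Matrix (a × b) (a × b) ℂ) :
    Matrix ((A × B) × (a × b)) ((A × B) × (a × b)) ℂ :=
  idTensor Λ (maxEntPair A B)

/-- The reduction `τ_{P Qᵢ}` of an operator `τ` on `P ⊗ Q₀ ⊗ ⋯ ⊗ Qₖ`: all factors `Qⱼ` with
`j ≠ i` are traced out. -/
def reduction {P Q : Type*} [Fintype Q] {k : ℕ} (i : Fin (k + 1))
    (τ : Matrix (P × (Fin (k + 1) → Q)) (P × (Fin (k + 1) → Q)) ℂ) :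
    Matrix (P × Q) (P × Q) ℂ :=
  Matrix.of fun x y =>
    ∑ g : Fin k → Q, τ (x.1, Fin.insertNth i x.2 g) (y.1, Fin.insertNth i y.2 g)

/-- A (not necessarily normalized) state `σ` on `P ⊗ Q` is `k`-extendible (on the second site) if
some positive semidefinite `τ` on `P ⊗ Q₀ ⊗ ⋯ ⊗ Qₖ` has all its reductions `τ_{P Qᵢ}` equal
to `σ`. -/
def IsExtendible {P Q : Type*} [Fintype Q] (k : ℕ) (σ : Matrix (P × Q) (P × Q) ℂ) : Prop :=
  ∃ τ : Matrix (P × (Fin (k + 1) → Q)) (P × (Fin (k + 1) → Q)) ℂ,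
    τ.PosSemidef ∧ ∀ i : Fin (k + 1), reduction i τ = σ

/-- A completely positive map `Λ` from operators on `AB` to operators on `ab`, not necessarily
trace preserving, is a `k`-extendible map if its Choi-Jamiolkowski state is `k`-extendible (on
Bob's site) with respect to the bipartition `Aa : Bb`. -/
def IsExtendibleMap {A B a b : Type*} [Fintype A] [Fintype B] [Fintype a] [Fintype b]
    [DecidableEq A] [DecidableEq B] [DecidableEq a] [DecidableEq b] (k : ℕ)
    (Λ : Matrix (A × B) (A × B) ℂ →CP Matrix (a × b) (a × b) ℂ) : Prop :=
  IsExtendible k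
    ((choi (Λ : Matrix (A × B) (A × B) ℂ →ₗ[ℂ] Matrix (a × b) (a × b) ℂ)).submatrix
      (fun x : (A × a) × (B × b) => ((x.1.1, x.2.1), (x.1.2, x.2.2)))
      (fun x : (A × a) × (B × b) => ((x.1.1, x.2.1), (x.1.2, x.2.2))))

/-- The fidelity `F(ρ, Λ) = tr(Λ(ρ) Φ⁺) / tr(Λ(ρ))` of the two-qubit output with `Φ⁺`; it is
meaningful only when `tr(Λ(ρ)) ≠ 0`. Numerator and denominator are real for a state `ρ`. -/
def fidelity {A B : Type*} [Fintype A] [Fintype B] [DecidableEq A] [DecidableEq B]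
    (ρ : Matrix (A × B) (A × B) ℂ)
    (Λ : Matrix (A × B) (A × B) ℂ →CP Matrix (Fin 2 × Fin 2) (Fin 2 × Fin 2) ℂ) : ℝ :=
  ((Λ ρ * maxEnt (Fin 2)).trace / (Λ ρ).trace).re

/-- The set of fidelities `F(ρ, Λ)` achieved on `ρ`, with nonzero probability, by `k`-extendible
maps `Λ` with two-qubit output. -/
def achievableFidelities {A B : Type*} [Fintype A] [Fintype B] [DecidableEq A] [DecidableEq B]
    (k : ℕ) (ρ : Matrix (A × B) (A × B) ℂ) : Set ℝ :=
  {F | ∃ Λ : Matrix (A × B) (A × B) ℂ →CP Matrix (Fin 2 × Fin 2) (Fin 2 × Fin 2) ℂ,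
    IsExtendibleMap k Λ ∧ (Λ ρ).trace ≠ 0 ∧ F = fidelity ρ Λ}

/-- The swap operator `V` on `ℂᵈ ⊗ ℂᵈ`. -/
def swapOp (d : ℕ) : Matrix (Fin d × Fin d) (Fin d × Fin d) ℂ :=
  Matrix.of fun x y => if x = y.swap then 1 else 0

/-- The Werner state `ρ_W(γ) = (I + γ V) / tr(I + γ V)` on `ℂᵈ ⊗ ℂᵈ`. -/
def werner (d : ℕ) (γ : ℝ) : Matrix (Fin d × Fin d) (Fin d × Fin d) ℂ :=
  (1 + (γ : ℂ) • swapOp d).trace⁻¹ • (1 + (γ : ℂ) • swapOp d)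

end

end ExtendibleMaps

/-! Upper bound: fidelity at most `F` means `tr (Λ(ρ) (F - Φ⁺)) ≥ 0`. Through the Choi operator this
is a trace against the extension `τ`, computed with either copy of Bob. Let `P`, `Q` swap Alice's
system with `B₀`, `B₁`, and let `R`, `S` be `Φ⁺` on `ab₀`, `ab₁`. Adding the two expressions, it
suffices that `(1 + γP) ⊗ (F - R) + (1 + γQ) ⊗ (F - S)` is positive (`posSemidef_werner_witness`).
It is half the sum of two products `D± ⊗ Z±`, where `D± = 2 + (γ ± a)P + (γ ∓ a)Q` and `Z±` is `F`
minus a convex combination of `R` and `S`. `D±` is positive by the representation theory of `S₃`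
(`posSemidef_two_add`), `Z±` by the geometry of two subspaces at a fixed angle
(`posSemidef_sub_mixture`). Only the relations among `P`, `Q` and among `R`, `S` enter, so `d` plays
no role.

Attainment: a pure state that changes sign when the two Bobs are exchanged has equal reductions,
hence defines a 1-extendible map (`pureMap_isExtendibleMap`). In a two-parameter family of such
states, built from two basis vectors of `ℂᵈ`, the fidelity is a quotient of 2×2 quadratic forms
whose largest value is `F` (`optimalFidelity_mem`). -/

namespace ExtendibleMaps

open Matrix
open scoped Kronecker

/-! ### Positivity of the witness from abstract relations. -/

section Algebra

variable {n : Type*} [Fintype n] [DecidableEq n]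

lemma trace_mul_nonneg {τ M : Matrix n n ℂ} (hτ : τ.PosSemidef) (hM : M.PosSemidef) :
    0 ≤ (τ * M).trace := by
  obtain ⟨B, rfl⟩ := CStarAlgebra.nonneg_iff_eq_star_mul_self.mp hM.nonneg
  rw [← mul_assoc, trace_mul_comm, ← mul_assoc]
  exact (hτ.mul_mul_conjTranspose_same B).trace_nonneg

omit [DecidableEq n] in
lemma posSemidef_mul_self {T : Matrix n n ℂ} (hT : T.IsHermitian) : (T * T).PosSemidef := by
  have := posSemidef_conjTranspose_mul_self T
  rwa [hT.eq] at this

omit [Fintype n] [DecidableEq n] in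
lemma isHermitian_real_smul (r : ℝ) {T : Matrix n n ℂ} (hT : T.IsHermitian) :
    (r • T).IsHermitian := by
  simp [IsHermitian, conjTranspose_smul, hT.eq]

/-- Two involutions satisfying the braid relation generate a copy of `S₃`; three times the
projector onto the invariants of its cyclic subgroup is positive. -/
lemma posSemidef_one_add_braid {P Q : Matrix n n ℂ} (hP : P.IsHermitian) (hQ : Q.IsHermitian)
    (hP2 : P * P = 1) (hQ2 : Q * Q = 1) (hPQ : P * Q * P = Q * P * Q) :
    (1 + P * Q + Q * P).PosSemidef := by
  have hS : (1 + P * Q + Q * P).IsHermitian := by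
    simp only [IsHermitian, conjTranspose_add, conjTranspose_mul, conjTranspose_one, hP.eq, hQ.eq]
    abel
  have e1 : P * Q * (P * Q) = Q * P := by
    rw [← mul_assoc, hPQ, mul_assoc, hQ2, mul_one]
  have e2 : Q * P * (Q * P) = P * Q := by
    rw [← mul_assoc, ← hPQ, mul_assoc, hP2, mul_one]
  have e3 : P * Q * (Q * P) = 1 := by
    rw [mul_assoc, ← mul_assoc Q, hQ2, one_mul, hP2]
  have e4 : Q * P * (P * Q) = 1 := by
    rw [mul_assoc, ← mul_assoc P, hP2, one_mul, hQ2]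
  have key : 1 + P * Q + Q * P =
      (3⁻¹ : ℝ) • ((1 + P * Q + Q * P) * (1 + P * Q + Q * P)) := by
    simp only [mul_add, add_mul, mul_one, one_mul, e1, e2, e3, e4]
    module
  rw [key]
  exact (posSemidef_mul_self hS).smul (by norm_num)

/-- In the two-dimensional representation of `S₃`, `αP + βQ` has eigenvalues `±√(α² + β² - αβ) =
±2`. In the one-dimensional ones it is `±(α + β)`, and `(α + β)² = 4 + 3αβ ≤ 4`. The identity `4T =
T² - αβ(1 + PQ + QP)` expresses this without decomposing the space. -/
lemma posSemidef_two_add {P Q : Matrix n n ℂ} (hP : P.IsHermitian) (hQ : Q.IsHermitian)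
    (hP2 : P * P = 1) (hQ2 : Q * Q = 1) (hPQ : P * Q * P = Q * P * Q) {α β : ℝ}
    (h : α ^ 2 + β ^ 2 - α * β = 4) (hαβ : α * β ≤ 0) :
    ((2 : ℝ) • (1 : Matrix n n ℂ) + α • P + β • Q).PosSemidef := by
  set T := (2 : ℝ) • (1 : Matrix n n ℂ) + α • P + β • Q with hT
  have hTh : T.IsHermitian :=
    ((isHermitian_real_smul 2 isHermitian_one).add (isHermitian_real_smul α hP)).add
      (isHermitian_real_smul β hQ)
  have key : T = (4⁻¹ : ℝ) • (T * T + (-(α * β)) • (1 + P * Q + Q * P)) := by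
    rw [hT]
    simp only [mul_add, add_mul, mul_one, one_mul, smul_mul_assoc, mul_smul_comm, hP2, hQ2]
    match_scalars <;> first | ring1 | linear_combination -h / 4
  rw [key]
  exact ((posSemidef_mul_self hTh).add
    ((posSemidef_one_add_braid hP hQ hP2 hQ2 hPQ).smul (by linarith))).smul (by norm_num)

/-- A convex combination of two projections of overlap `1/4` is bounded by the larger root `F` of
`F (1 - F) = (3/4) t (1 - t)`. -/
lemma posSemidef_sub_mixture {R S : Matrix n n ℂ} (hR : R.IsHermitian) (hS : S.IsHermitian)
    (hR2 : R * R = R) (hS2 : S * S = S) (hRSR : R * S * R = (4⁻¹ : ℝ) • R)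
    (hSRS : S * R * S = (4⁻¹ : ℝ) • S) {F t : ℝ} (hF : 1 / 2 < F)
    (h : F * (1 - F) = 3 / 4 * (t * (1 - t))) :
    (F • (1 : Matrix n n ℂ) - t • R - (1 - t) • S).PosSemidef := by
  -- `K` projects onto the span of the ranges of `R` and `S`; the factor is `1 / (1 - 1/4)`.
  set K := (4 / 3 : ℝ) • (R + S - R * S - S * R) with hK
  have hKh : K.IsHermitian := by
    refine isHermitian_real_smul _ ?_
    simp only [IsHermitian, conjTranspose_add, conjTranspose_sub, conjTranspose_mul, hR.eq, hS.eq]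
    abel
  have hKR : K * R = R := by
    simp only [hK, sub_mul, add_mul, smul_mul_assoc, hR2, hRSR, mul_assoc S R R]
    module
  have hKS : K * S = S := by
    simp only [hK, sub_mul, add_mul, smul_mul_assoc, hS2, hSRS, mul_assoc R S S]
    module
  have hRK : R * K = R := by
    simpa [conjTranspose_mul, hR.eq, hKh.eq] using congrArg conjTranspose hKR
  have hSK : S * K = S := by
    simpa [conjTranspose_mul, hS.eq, hKh.eq] using congrArg conjTranspose hKS
  have hKK : K * K = K := by
    refine (congrArg (· * K) hK).trans (Eq.trans ?_ hK.symm)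
    simp only [smul_mul_assoc, sub_mul, add_mul, hRK, hSK, mul_assoc]
  set Y := F • K - t • R - (1 - t) • S with hY
  have hYh : Y.IsHermitian :=
    ((isHermitian_real_smul F hKh).sub (isHermitian_real_smul t hR)).sub
      (isHermitian_real_smul _ hS)
  -- On the range of `K` the mixture has eigenvalues `F` and `1 - F`: in each two-dimensional block
  -- the trace is `1` and the determinant `(3/4) t (1 - t)`. So `Y` has eigenvalues `0` and `2F -
  -- 1`.
  have hYY : Y * Y = (2 * F - 1) • Y := by
    simp only [hY, mul_sub, sub_mul, smul_mul_assoc, mul_smul_comm, hR2, hS2, hKR, hKS, hRK, hSK,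
      hKK]
    rw [hK]
    match_scalars <;> first | ring1 | linear_combination (-4 / 3) * h | linear_combination (4 / 3) * h
  have h1K : ((1 : Matrix n n ℂ) - K) = (1 - K) * (1 - K) := by
    simp only [mul_sub, sub_mul, hKK, mul_one, one_mul]
    abel
  have key : F • (1 : Matrix n n ℂ) - t • R - (1 - t) • S =
      F • ((1 - K) * (1 - K)) + (2 * F - 1)⁻¹ • (Y * Y) := by
    rw [hYY, ← h1K, smul_smul, inv_mul_cancel₀ (by linarith), hY]
    module
  rw [key]
  refine ((posSemidef_mul_self (isHermitian_one.sub hKh)).smul (by linarith)).add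
    ((posSemidef_mul_self hYh).smul ?_)
  exact inv_nonneg.mpr (by linarith)

lemma posSemidef_werner_witness {m : Type*} [Fintype m] [DecidableEq m]
    {P Q : Matrix n n ℂ} (hP : P.IsHermitian) (hQ : Q.IsHermitian)
    (hP2 : P * P = 1) (hQ2 : Q * Q = 1) (hPQ : P * Q * P = Q * P * Q)
    {R S : Matrix m m ℂ} (hR : R.IsHermitian) (hS : S.IsHermitian)
    (hR2 : R * R = R) (hS2 : S * S = S) (hRSR : R * S * R = (4⁻¹ : ℝ) • R)
    (hSRS : S * R * S = (4⁻¹ : ℝ) • S) {γ F : ℝ} (hγ₁ : -1 ≤ γ) (hγ₂ : γ ≤ 1) (hF : 1 / 2 < F)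
    (h : (4 - γ ^ 2) * (2 * F - 1) ^ 2 = 1 + 2 * γ ^ 2) :
    ((1 + γ • P) ⊗ₖ (F • (1 : Matrix m m ℂ) - R) +
      (1 + γ • Q) ⊗ₖ (F • (1 : Matrix m m ℂ) - S)).PosSemidef := by
  -- The value of `a` is forced by `α² + β² - αβ = γ² + 3a² = 4` for `α, β = γ ± a`. The weights `(1
  -- ± c)/2` need `ca = γ`, so that the cross term `(P - Q) ⊗ (R - S)` gets the coefficient `-γ/2`.
  have hγ : 0 < (4 - γ ^ 2) / 3 := by nlinarith
  obtain ⟨a, ha, ha2⟩ : ∃ a : ℝ, 0 < a ∧ a ^ 2 = (4 - γ ^ 2) / 3 :=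
    ⟨Real.sqrt ((4 - γ ^ 2) / 3), Real.sqrt_pos.mpr hγ, Real.sq_sqrt hγ.le⟩
  obtain ⟨c, hc⟩ : ∃ c : ℝ, γ = c * a := ⟨γ / a, by field_simp⟩
  have hFc : (2 * F - 1) ^ 2 = (1 + 3 * c ^ 2) / 4 := by
    have h2 : 4 - γ ^ 2 = 3 * a ^ 2 := by linarith
    have h3 : 1 + 2 * γ ^ 2 = 3 / 4 * a ^ 2 * (1 + 3 * c ^ 2) := by
      have : γ ^ 2 = c ^ 2 * a ^ 2 := by rw [hc]; ring
      linarith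
    rw [h2, h3] at h
    have : 3 * a ^ 2 ≠ 0 := by positivity
    apply mul_left_cancel₀ this
    linarith
  have hD (s : ℝ) (hs : s ^ 2 = 1) :
      ((2 : ℝ) • (1 : Matrix n n ℂ) + (γ + s * a) • P + (γ - s * a) • Q).PosSemidef := by
    apply posSemidef_two_add hP hQ hP2 hQ2 hPQ
    · linear_combination 3 * a ^ 2 * hs + 3 * ha2
    · have : (γ + s * a) * (γ - s * a) = γ ^ 2 - a ^ 2 := by linear_combination -a ^ 2 * hs
      rw [this, ha2]
      -- Here `γ² - a² = 4(γ² - 1)/3`, which is nonpositive because `|γ| ≤ 1`.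
      nlinarith
  have hZ (s : ℝ) (hs : s ^ 2 = 1) :
      (F • (1 : Matrix m m ℂ) - ((1 + s * c) / 2) • R - (1 - (1 + s * c) / 2) • S).PosSemidef := by
    apply posSemidef_sub_mixture hR hS hR2 hS2 hRSR hSRS hF
    linear_combination -hFc / 4 + 3 / 16 * c ^ 2 * hs
  have key : (1 + γ • P) ⊗ₖ (F • (1 : Matrix m m ℂ) - R) +
      (1 + γ • Q) ⊗ₖ (F • (1 : Matrix m m ℂ) - S) = (2⁻¹ : ℝ) •
      (((2 : ℝ) • (1 : Matrix n n ℂ) + (γ + 1 * a) • P + (γ - 1 * a) • Q) ⊗ₖ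
        (F • (1 : Matrix m m ℂ) - ((1 + 1 * c) / 2) • R - (1 - (1 + 1 * c) / 2) • S) +
      ((2 : ℝ) • (1 : Matrix n n ℂ) + (γ + (-1) * a) • P + (γ - (-1) * a) • Q) ⊗ₖ
        (F • (1 : Matrix m m ℂ) - ((1 + (-1) * c) / 2) • R - (1 - (1 + (-1) * c) / 2) • S)) := by
    simp only [sub_eq_add_neg, ← neg_smul, ← neg_one_smul ℝ R, ← neg_one_smul ℝ S, kronecker_add,
      add_kronecker, smul_kronecker, kronecker_smul]
    rw [hc]
    module
  rw [key]
  exact (((hD 1 (by norm_num)).kronecker (hZ 1 (by norm_num))).add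
    ((hD (-1) (by norm_num)).kronecker (hZ (-1) (by norm_num)))).smul (by norm_num)

end Algebra

/-! ### Operators and partial traces with two copies of Bob. -/

section TwoBobs

/-- The exchange of the two copies of Bob's factor. -/
def exchange (A B : Type*) : A × B × B ≃ A × B × B where
  toFun p := (p.1, p.2.2, p.2.1)
  invFun p := (p.1, p.2.2, p.2.1)
  left_inv _ := rfl
  right_inv _ := rfl

/-- `X ⊗ 1` on `A ⊗ B₀ ⊗ B₁`, with `X` acting on `A ⊗ B₀`. -/
def actOnFirst {A B R : Type*} [DecidableEq B] [Zero R] (X : Matrix (A × B) (A × B) R) :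
    Matrix (A × B × B) (A × B × B) R :=
  of fun p q => if p.2.2 = q.2.2 then X (p.1, p.2.1) (q.1, q.2.1) else 0

/-- `X ⊗ 1` on `A ⊗ B₀ ⊗ B₁`, with `X` acting on `A ⊗ B₁`. -/
def actOnSecond {A B R : Type*} [DecidableEq B] [Zero R] (X : Matrix (A × B) (A × B) R) :
    Matrix (A × B × B) (A × B × B) R :=
  (actOnFirst X).submatrix (exchange A B) (exchange A B)

/-- The regrouping of `(A ⊗ B₀ ⊗ B₁) ⊗ (a ⊗ b₀ ⊗ b₁)` as `Aa ⊗ B₀b₀ ⊗ B₁b₁`. -/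
def regroup (A B a b : Type*) : (A × B × B) × (a × b × b) ≃ (A × a) × (Fin 2 → B × b) where
  toFun u := ((u.1.1, u.2.1), ![(u.1.2.1, u.2.2.1), (u.1.2.2, u.2.2.2)])
  invFun v := ((v.1.1, (v.2 0).1, (v.2 1).1), (v.1.2, (v.2 0).2, (v.2 1).2))
  left_inv _ := rfl
  right_inv v := by
    ext i
    · rfl
    · rfl
    · fin_cases i <;> rfl
    · fin_cases i <;> rfl

variable {A B a b : Type*}

/-- The partial trace over the second copy of Bob's system. -/
def traceSecond [Fintype B] [Fintype b]
    (T : Matrix ((A × B × B) × (a × b × b)) ((A × B × B) × (a × b × b)) ℂ) :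
    Matrix ((A × B) × (a × b)) ((A × B) × (a × b)) ℂ :=
  of fun u v => ∑ g : B × b, T ((u.1.1, u.1.2, g.1), (u.2.1, u.2.2, g.2))
    ((v.1.1, v.1.2, g.1), (v.2.1, v.2.2, g.2))

/-- The second copy of Bob's system is moved to the right. -/
def splitSecond (A B a b : Type*) :
    (A × B × B) × (a × b × b) ≃ ((A × B) × (a × b)) × (B × b) where
  toFun u := (((u.1.1, u.1.2.1), (u.2.1, u.2.2.1)), (u.1.2.2, u.2.2.2))
  invFun v := ((v.1.1.1, v.1.1.2, v.2.1), (v.1.2.1, v.1.2.2, v.2.2))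
  left_inv _ := rfl
  right_inv _ := rfl

variable [Fintype A] [Fintype B] [Fintype a] [Fintype b]
  [DecidableEq A] [DecidableEq B] [DecidableEq a] [DecidableEq b]

omit [DecidableEq A] [DecidableEq a] in
lemma trace_mul_kronecker_actOnFirst
    (T : Matrix ((A × B × B) × (a × b × b)) ((A × B × B) × (a × b × b)) ℂ)
    (X : Matrix (A × B) (A × B) ℂ) (W : Matrix (a × b) (a × b) ℂ) :
    (T * (actOnFirst X ⊗ₖ actOnFirst W)).trace = (traceSecond T * (X ⊗ₖ W)).trace := by
  simp only [trace, diag, mul_apply]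
  rw [← (splitSecond A B a b).symm.sum_comp, Fintype.sum_prod_type]
  refine Finset.sum_congr rfl fun u _ => ?_
  have (g : B × b) : ∑ v, T ((splitSecond A B a b).symm (u, g)) v *
      (actOnFirst X ⊗ₖ actOnFirst W) v ((splitSecond A B a b).symm (u, g)) =
      ∑ v, T ((splitSecond A B a b).symm (u, g)) ((splitSecond A B a b).symm (v, g)) *
        (X ⊗ₖ W) v u := by
    rw [← (splitSecond A B a b).symm.sum_comp, Fintype.sum_prod_type]
    refine Finset.sum_congr rfl fun v _ => ?_
    rw [Finset.sum_eq_single g]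
    · simp [splitSecond, actOnFirst]
    · rintro ⟨g₁, g₂⟩ - hg
      have : ¬ (g₁ = g.1 ∧ g₂ = g.2) := fun h => hg (Prod.ext h.1 h.2)
      simp only [splitSecond, actOnFirst, kroneckerMap_apply, of_apply, Equiv.coe_fn_symm_mk]
      by_cases h1 : g₁ = g.1 <;> by_cases h2 : g₂ = g.2 <;> simp_all
    · simp
  simp only [this]
  rw [Finset.sum_comm]
  refine Finset.sum_congr rfl fun v _ => ?_
  rw [← Finset.sum_mul]
  rfl

omit [DecidableEq A] [DecidableEq a] in
lemma trace_mul_kronecker_actOnSecond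
    (T : Matrix ((A × B × B) × (a × b × b)) ((A × B × B) × (a × b × b)) ℂ)
    (X : Matrix (A × B) (A × B) ℂ) (W : Matrix (a × b) (a × b) ℂ) :
    (T * (actOnSecond X ⊗ₖ actOnSecond W)).trace =
      (traceSecond (T.submatrix (Prod.map (exchange A B) (exchange a b))
        (Prod.map (exchange A B) (exchange a b))) * (X ⊗ₖ W)).trace := by
  rw [← trace_mul_kronecker_actOnFirst]
  simp only [trace, diag, mul_apply]
  rw [← ((exchange A B).prodCongr (exchange a b)).sum_comp]
  refine Finset.sum_congr rfl fun u _ => ?_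
  rw [← ((exchange A B).prodCongr (exchange a b)).sum_comp]
  rfl

omit [Fintype A] [Fintype a] [DecidableEq A] [DecidableEq B] [DecidableEq a] [DecidableEq b] in
lemma reduction_zero_eq (τ : Matrix ((A × a) × (Fin 2 → B × b)) ((A × a) × (Fin 2 → B × b)) ℂ)
    (u v : (A × B) × (a × b)) :
    reduction (k := 1) 0 τ ((u.1.1, u.2.1), (u.1.2, u.2.2)) ((v.1.1, v.2.1), (v.1.2, v.2.2)) =
      traceSecond (τ.submatrix (regroup A B a b) (regroup A B a b)) u v := by
  simp only [reduction, traceSecond, of_apply, submatrix_apply, regroup]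
  rw [← (Equiv.funUnique (Fin 1) (B × b)).symm.sum_comp]
  refine Finset.sum_congr rfl fun g _ => ?_
  congr 2 <;> (ext i : 1; fin_cases i <;> rfl)

omit [Fintype A] [Fintype a] [DecidableEq A] [DecidableEq B] [DecidableEq a] [DecidableEq b] in
lemma reduction_one_eq (τ : Matrix ((A × a) × (Fin 2 → B × b)) ((A × a) × (Fin 2 → B × b)) ℂ)
    (u v : (A × B) × (a × b)) :
    reduction (k := 1) 1 τ ((u.1.1, u.2.1), (u.1.2, u.2.2)) ((v.1.1, v.2.1), (v.1.2, v.2.2)) =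
      traceSecond ((τ.submatrix (regroup A B a b) (regroup A B a b)).submatrix
        (Prod.map (exchange A B) (exchange a b)) (Prod.map (exchange A B) (exchange a b))) u v := by
  simp only [reduction, traceSecond, of_apply, submatrix_apply, regroup, Equiv.coe_fn_mk,
    exchange, Prod.map]
  rw [← (Equiv.funUnique (Fin 1) (B × b)).symm.sum_comp]
  refine Finset.sum_congr rfl fun g _ => ?_
  congr 2 <;> (ext i : 1; fin_cases i <;> rfl)

end TwoBobs

/-! ### Trace pairings through the Choi operator. -/

section Choi

variable {A B a b : Type*} [Fintype A] [Fintype B] [Fintype a] [Fintype b]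
  [DecidableEq A] [DecidableEq B] [DecidableEq a] [DecidableEq b]

lemma maxEnt_apply (ι : Type*) [Fintype ι] [DecidableEq ι] (x y : ι × ι) :
    maxEnt ι x y = if x.1 = x.2 ∧ y.1 = y.2 then (Fintype.card ι : ℂ)⁻¹ else 0 := by
  have : (((Real.sqrt (Fintype.card ι))⁻¹ : ℝ) : ℂ) * (((Real.sqrt (Fintype.card ι))⁻¹ : ℝ) : ℂ) =
      (Fintype.card ι : ℂ)⁻¹ := by
    rw [← Complex.ofReal_mul, ← mul_inv, Real.mul_self_sqrt (by positivity)]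
    simp
  simp only [maxEnt, vecMulVec_apply, maxEntVec, Pi.star_apply]
  by_cases h1 : x.1 = x.2 <;> by_cases h2 : y.1 = y.2 <;> simp [h1, h2, ← this]

omit [Fintype a] [Fintype b] [DecidableEq a] [DecidableEq b] in
lemma choi_apply (Λ : Matrix (A × B) (A × B) ℂ →ₗ[ℂ] Matrix (a × b) (a × b) ℂ)
    (u v : (A × B) × (a × b)) :
    choi Λ u v = ((Fintype.card A : ℂ) * Fintype.card B)⁻¹ *
      Λ (Matrix.single u.1 v.1 1) u.2 v.2 := by
  have : (Matrix.of fun x y => maxEntPair A B (u.1, x) (v.1, y)) =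
      ((Fintype.card A : ℂ) * Fintype.card B)⁻¹ • Matrix.single u.1 v.1 1 := by
    ext ⟨x₁, x₂⟩ ⟨y₁, y₂⟩
    obtain ⟨⟨u₁, u₂⟩, u⟩ := u
    obtain ⟨⟨v₁, v₂⟩, v⟩ := v
    simp only [maxEntPair, maxEnt_apply, of_apply, Matrix.smul_apply, single_apply, Prod.mk.injEq,
      smul_eq_mul, mul_inv]
    split_ifs <;> simp_all
  simp only [choi, idTensor, of_apply, this, map_smul, Matrix.smul_apply, smul_eq_mul]

omit [DecidableEq a] [DecidableEq b] in
-- The prefactor undoes the normalization of the two maximally entangled states in `choi`.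
lemma trace_map_mul [Nonempty A] [Nonempty B]
    (Λ : Matrix (A × B) (A × B) ℂ →ₗ[ℂ] Matrix (a × b) (a × b) ℂ)
    (ρ : Matrix (A × B) (A × B) ℂ) (W : Matrix (a × b) (a × b) ℂ) :
    (Λ ρ * W).trace = ((Fintype.card A : ℂ) * Fintype.card B) * (choi Λ * (ρᵀ ⊗ₖ W)).trace := by
  have hc : (Fintype.card A : ℂ) * Fintype.card B ≠ 0 := by
    simp [Fintype.card_ne_zero]
  have hΛ (p q) : Λ ρ p q = ∑ x, ∑ y, ρ x y * Λ (Matrix.single x y 1) p q := by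
    conv_lhs => rw [matrix_eq_sum_single ρ]
    simp only [map_sum, Matrix.sum_apply]
    refine Finset.sum_congr rfl fun x _ => Finset.sum_congr rfl fun y _ => ?_
    rw [← mul_one (ρ x y), ← smul_eq_mul, ← smul_single, map_smul]
    simp
  simp only [trace, diag, mul_apply, choi_apply, Finset.mul_sum, Fintype.sum_prod_type (α₂ := a × b),
    kroneckerMap_apply, transpose_apply]
  rw [Finset.sum_comm (s := (Finset.univ : Finset (A × B)))]
  refine Finset.sum_congr rfl fun p _ => ?_
  simp only [hΛ, Finset.sum_mul]
  rw [Finset.sum_comm]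
  refine Finset.sum_congr rfl fun x _ => ?_
  rw [Finset.sum_comm]
  refine Finset.sum_congr rfl fun y _ => Finset.sum_congr rfl fun q _ => ?_
  field_simp

omit [DecidableEq a] in
/-- The trace pairing of an extendible map with an observable, in terms of the extension. -/
lemma trace_map_mul_eq_trace_extension [Nonempty A] [Nonempty B]
    {Λ : Matrix (A × B) (A × B) ℂ →ₗ[ℂ] Matrix (a × b) (a × b) ℂ}
    {τ : Matrix ((A × a) × (Fin 2 → B × b)) ((A × a) × (Fin 2 → B × b)) ℂ}
    (hτ : ∀ i : Fin (1 + 1), reduction i τ = (choi Λ).submatrix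
      (fun x : (A × a) × (B × b) => ((x.1.1, x.2.1), (x.1.2, x.2.2)))
      (fun x : (A × a) × (B × b) => ((x.1.1, x.2.1), (x.1.2, x.2.2))))
    (ρ : Matrix (A × B) (A × B) ℂ) (W : Matrix (a × b) (a × b) ℂ) :
    (Λ ρ * W).trace = ((Fintype.card A : ℂ) * Fintype.card B) *
        (τ.submatrix (regroup A B a b) (regroup A B a b) *
          (actOnFirst ρᵀ ⊗ₖ actOnFirst W)).trace ∧
    (Λ ρ * W).trace = ((Fintype.card A : ℂ) * Fintype.card B) *
        (τ.submatrix (regroup A B a b) (regroup A B a b) *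
          (actOnSecond ρᵀ ⊗ₖ actOnSecond W)).trace := by
  have h0 : traceSecond (τ.submatrix (regroup A B a b) (regroup A B a b)) = choi Λ := by
    ext u v
    rw [← reduction_zero_eq, hτ 0]
    rfl
  have h1 : traceSecond ((τ.submatrix (regroup A B a b) (regroup A B a b)).submatrix
      (Prod.map (exchange A B) (exchange a b)) (Prod.map (exchange A B) (exchange a b))) =
      choi Λ := by
    ext u v
    rw [← reduction_one_eq, hτ 1]
    rfl
  rw [trace_mul_kronecker_actOnFirst, trace_mul_kronecker_actOnSecond, h0, h1]
  exact ⟨trace_map_mul Λ ρ W, trace_map_mul Λ ρ W⟩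

end Choi

/-! ### Compatibility of the two embeddings with the matrix operations. -/

section ActOn

variable {A B : Type*} [DecidableEq B]

lemma actOnFirst_one [DecidableEq A] : actOnFirst (1 : Matrix (A × B) (A × B) ℂ) = 1 := by
  ext ⟨p, q, r⟩ ⟨p', q', r'⟩
  simp only [actOnFirst, of_apply, one_apply, Prod.mk.injEq]
  split_ifs <;> simp_all

lemma actOnFirst_add (X Y : Matrix (A × B) (A × B) ℂ) :
    actOnFirst (X + Y) = actOnFirst X + actOnFirst Y := by
  ext p q
  simp only [actOnFirst, of_apply, Matrix.add_apply]
  split_ifs <;> simp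

lemma actOnFirst_sub (X Y : Matrix (A × B) (A × B) ℂ) :
    actOnFirst (X - Y) = actOnFirst X - actOnFirst Y := by
  ext p q
  simp only [actOnFirst, of_apply, Matrix.sub_apply]
  split_ifs <;> simp

lemma actOnFirst_smul (r : ℝ) (X : Matrix (A × B) (A × B) ℂ) :
    actOnFirst (r • X) = r • actOnFirst X := by
  ext p q
  simp only [actOnFirst, of_apply, Matrix.smul_apply]
  split_ifs <;> simp

lemma actOnFirst_isHermitian {X : Matrix (A × B) (A × B) ℂ} (hX : X.IsHermitian) :
    (actOnFirst X).IsHermitian := by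
  ext p q
  have := hX.apply (p.1, p.2.1) (q.1, q.2.1)
  simp only [conjTranspose_apply, actOnFirst, of_apply, eq_comm (a := q.2.2)]
  split_ifs <;> simp_all

lemma actOnSecond_one [DecidableEq A] : actOnSecond (1 : Matrix (A × B) (A × B) ℂ) = 1 := by
  rw [actOnSecond, actOnFirst_one, submatrix_one_equiv]

lemma actOnSecond_add (X Y : Matrix (A × B) (A × B) ℂ) :
    actOnSecond (X + Y) = actOnSecond X + actOnSecond Y := by
  simp [actOnSecond, actOnFirst_add, submatrix_add]

lemma actOnSecond_sub (X Y : Matrix (A × B) (A × B) ℂ) :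
    actOnSecond (X - Y) = actOnSecond X - actOnSecond Y := by
  simp [actOnSecond, actOnFirst_sub, submatrix_sub]

lemma actOnSecond_smul (r : ℝ) (X : Matrix (A × B) (A × B) ℂ) :
    actOnSecond (r • X) = r • actOnSecond X := by
  simp [actOnSecond, actOnFirst_smul, submatrix_smul]

lemma actOnSecond_isHermitian {X : Matrix (A × B) (A × B) ℂ} (hX : X.IsHermitian) :
    (actOnSecond X).IsHermitian :=
  (actOnFirst_isHermitian hX).submatrix _

end ActOn

/-! ### Swap operators and the Werner state. -/

section Swap

variable (d : ℕ)

lemma swapOp_transpose : (swapOp d)ᵀ = swapOp d := by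
  ext x y
  have : y = x.swap ↔ x = y.swap := by
    constructor <;> (rintro rfl; simp)
  simp [swapOp, this]

lemma swapOp_isHermitian : (swapOp d).IsHermitian := by
  ext x y
  have : y = x.swap ↔ x = y.swap := by
    constructor <;> (rintro rfl; simp)
  simp only [conjTranspose_apply, swapOp, of_apply, this]
  split_ifs <;> simp

/-- The exchange of Alice's factor with the first copy of Bob's factor. -/
def exchangeFirst : Equiv.Perm (Fin d × Fin d × Fin d) where
  toFun p := (p.2.1, p.1, p.2.2)
  invFun p := (p.2.1, p.1, p.2.2)
  left_inv _ := rfl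
  right_inv _ := rfl

/-- The exchange of Alice's factor with the second copy of Bob's factor. -/
def exchangeSecond : Equiv.Perm (Fin d × Fin d × Fin d) where
  toFun p := (p.2.2, p.2.1, p.1)
  invFun p := (p.2.2, p.2.1, p.1)
  left_inv _ := rfl
  right_inv _ := rfl

lemma actOnFirst_swapOp : actOnFirst (swapOp d) = (exchangeFirst d).permMatrix ℂ := by
  ext ⟨p, q, r⟩ ⟨p', q', r'⟩
  simp only [actOnFirst, swapOp, of_apply, PEquiv.toMatrix_apply, Equiv.toPEquiv_apply,
    exchangeFirst, Prod.swap, Equiv.coe_fn_mk, Option.mem_def, Option.some.injEq, Prod.mk.injEq]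
  split_ifs <;> simp_all

lemma actOnSecond_swapOp : actOnSecond (swapOp d) = (exchangeSecond d).permMatrix ℂ := by
  ext ⟨p, q, r⟩ ⟨p', q', r'⟩
  simp only [actOnSecond, actOnFirst, swapOp, of_apply, PEquiv.toMatrix_apply,
    Equiv.toPEquiv_apply, exchange, submatrix_apply,
    exchangeSecond, Prod.swap, Equiv.coe_fn_mk, Option.mem_def, Option.some.injEq, Prod.mk.injEq]
  split_ifs <;> simp_all

lemma actOnFirst_swapOp_mul_self : actOnFirst (swapOp d) * actOnFirst (swapOp d) = 1 := by
  rw [actOnFirst_swapOp, ← permMatrix_mul, ← permMatrix_one]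
  rfl

lemma actOnSecond_swapOp_mul_self : actOnSecond (swapOp d) * actOnSecond (swapOp d) = 1 := by
  rw [actOnSecond_swapOp, ← permMatrix_mul, ← permMatrix_one]
  rfl

/-- Both sides are the permutation exchanging the two copies of Bob. -/
lemma actOn_swapOp_braid :
    actOnFirst (swapOp d) * actOnSecond (swapOp d) * actOnFirst (swapOp d) =
      actOnSecond (swapOp d) * actOnFirst (swapOp d) * actOnSecond (swapOp d) := by
  simp only [actOnFirst_swapOp, actOnSecond_swapOp, ← permMatrix_mul]
  rfl

lemma werner_eq (hd : 2 ≤ d) {γ : ℝ} (hγ : -1 ≤ γ) :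
    ∃ c : ℝ, 0 < c ∧ werner d γ = c • (1 + γ • swapOp d) := by
  have ht : (swapOp d).trace = d := by
    have (x : Fin d × Fin d) : x = x.swap ↔ x.1 = x.2 := by
      obtain ⟨i, j⟩ := x
      simp [eq_comm]
    simp only [trace, diag, swapOp, of_apply, this, Fintype.sum_prod_type]
    simp
  have ht' : (1 + (γ : ℂ) • swapOp d).trace = ((d * d + γ * d : ℝ) : ℂ) := by
    rw [trace_add, trace_smul, ht, trace_one]
    simp
  have hpos : (0 : ℝ) < d * d + γ * d := by
    have : (2 : ℝ) ≤ d := by exact_mod_cast hd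
    nlinarith
  refine ⟨(d * d + γ * d : ℝ)⁻¹, inv_pos.mpr hpos, ?_⟩
  rw [werner, ht', ← Complex.ofReal_inv]
  rfl

end Swap

/-! ### Relations between the two Bell projections. -/

section Qubits

/-- Twice the maximally entangled state of two qubits, as an integer matrix. -/
def bellInt : Matrix (Fin 2 × Fin 2) (Fin 2 × Fin 2) ℤ :=
  of fun x y => if x.1 = x.2 ∧ y.1 = y.2 then 1 else 0

lemma actOnFirst_maxEnt :
    actOnFirst (maxEnt (Fin 2)) = (2⁻¹ : ℝ) • (Int.castRingHom ℂ).mapMatrix (actOnFirst bellInt) := by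
  ext p q
  simp only [actOnFirst, of_apply, maxEnt_apply, bellInt, Matrix.smul_apply,
    RingHom.mapMatrix_apply, map_apply]
  split_ifs <;> simp

lemma actOnSecond_maxEnt :
    actOnSecond (maxEnt (Fin 2)) =
      (2⁻¹ : ℝ) • (Int.castRingHom ℂ).mapMatrix (actOnSecond bellInt) := by
  rw [actOnSecond, actOnFirst_maxEnt]
  rfl

lemma maxEnt_isHermitian (ι : Type*) [Fintype ι] [DecidableEq ι] : (maxEnt ι).IsHermitian := by
  simp [maxEnt, IsHermitian, conjTranspose_vecMulVec]

lemma maxEnt_relations :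
    (actOnFirst (maxEnt (Fin 2)) * actOnFirst (maxEnt (Fin 2)) = actOnFirst (maxEnt (Fin 2)) ∧
      actOnSecond (maxEnt (Fin 2)) * actOnSecond (maxEnt (Fin 2)) =
        actOnSecond (maxEnt (Fin 2))) ∧
    actOnFirst (maxEnt (Fin 2)) * actOnSecond (maxEnt (Fin 2)) * actOnFirst (maxEnt (Fin 2)) =
        (4⁻¹ : ℝ) • actOnFirst (maxEnt (Fin 2)) ∧
      actOnSecond (maxEnt (Fin 2)) * actOnFirst (maxEnt (Fin 2)) * actOnSecond (maxEnt (Fin 2)) =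
        (4⁻¹ : ℝ) • actOnSecond (maxEnt (Fin 2)) := by
  -- Doubling clears the denominators, so the relations become decidable identities of integer
  -- matrices.
  have h1 : actOnFirst bellInt * actOnFirst bellInt =
      actOnFirst bellInt + actOnFirst bellInt := by decide +kernel
  have h2 : actOnSecond bellInt * actOnSecond bellInt =
      actOnSecond bellInt + actOnSecond bellInt := by decide +kernel
  have h3 : actOnFirst bellInt * actOnSecond bellInt * actOnFirst bellInt =
      actOnFirst bellInt := by decide +kernel
  have h4 : actOnSecond bellInt * actOnFirst bellInt * actOnSecond bellInt =
      actOnSecond bellInt := by decide +kernel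
  simp only [actOnFirst_maxEnt, actOnSecond_maxEnt, smul_mul_assoc, mul_smul_comm, ← map_mul,
    h1, h2, h3, h4, map_add]
  refine ⟨⟨?_, ?_⟩, ?_, ?_⟩ <;> module

end Qubits

/-! ### The upper bound. -/

/-- The optimal fidelity for the Werner state `ρ_W(γ)`. -/
noncomputable def optimalFidelity (γ : ℝ) : ℝ :=
  1 / 2 + 1 / 2 * Real.sqrt ((1 + 2 * γ ^ 2) / (4 - γ ^ 2))

lemma half_lt_optimalFidelity {γ : ℝ} (hγ₁ : -1 ≤ γ) (hγ₂ : γ ≤ 1) :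
    1 / 2 < optimalFidelity γ := by
  have : 0 < (1 + 2 * γ ^ 2) / (4 - γ ^ 2) := div_pos (by positivity) (by nlinarith)
  have := Real.sqrt_pos.mpr this
  unfold optimalFidelity
  linarith

lemma optimalFidelity_equation {γ : ℝ} (hγ₁ : -1 ≤ γ) (hγ₂ : γ ≤ 1) :
    (4 - γ ^ 2) * (2 * optimalFidelity γ - 1) ^ 2 = 1 + 2 * γ ^ 2 := by
  have h4 : 0 < 4 - γ ^ 2 := by nlinarith
  have : 0 < (1 + 2 * γ ^ 2) / (4 - γ ^ 2) := div_pos (by positivity) h4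
  have h : 2 * optimalFidelity γ - 1 = Real.sqrt ((1 + 2 * γ ^ 2) / (4 - γ ^ 2)) := by
    unfold optimalFidelity
    ring
  rw [h, Real.sq_sqrt this.le]
  field_simp

lemma map_posSemidef {m n : Type} [Fintype m] [Fintype n] [DecidableEq m] [DecidableEq n]
    (Λ : Matrix m m ℂ →CP Matrix n n ℂ) {ρ : Matrix m m ℂ} (hρ : ρ.PosSemidef) :
    (Λ ρ).PosSemidef :=
  nonneg_iff_posSemidef.mp (map_nonneg Λ hρ.nonneg)

lemma werner_posSemidef (d : ℕ) (hd : 2 ≤ d) {γ : ℝ} (hγ₁ : -1 ≤ γ) (hγ₂ : γ ≤ 1) :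
    (werner d γ).PosSemidef := by
  obtain ⟨c, hc, h⟩ := werner_eq d hd hγ₁
  have hV : swapOp d * swapOp d = 1 := by
    ext x y
    simp [swapOp, mul_apply, one_apply]
  -- Spectral decomposition: `(1 ∓ V)²/4` are the projections onto the antisymmetric and symmetric
  -- subspaces.
  have hh : (1 + γ • swapOp d) = ((1 - γ) / 4) • ((1 - swapOp d) * (1 - swapOp d)) +
      ((1 + γ) / 4) • ((1 + swapOp d) * (1 + swapOp d)) := by
    simp only [mul_add, mul_sub, add_mul, sub_mul, mul_one, one_mul, hV]
    module
  rw [h, hh]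
  exact (((posSemidef_mul_self (isHermitian_one.sub (swapOp_isHermitian d))).smul
    (by linarith)).add ((posSemidef_mul_self (isHermitian_one.add (swapOp_isHermitian d))).smul
    (by linarith))).smul hc.le

theorem fidelity_le_optimalFidelity (d : ℕ) (hd : 2 ≤ d) {γ : ℝ} (hγ₁ : -1 ≤ γ) (hγ₂ : γ ≤ 1)
    {Λ : Matrix (Fin d × Fin d) (Fin d × Fin d) ℂ →CP Matrix (Fin 2 × Fin 2) (Fin 2 × Fin 2) ℂ}
    (hΛ : IsExtendibleMap 1 Λ) (h0 : (Λ (werner d γ)).trace ≠ 0) :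
    fidelity (werner d γ) Λ ≤ optimalFidelity γ := by
  obtain ⟨τ, hτ, hred⟩ := hΛ
  have : NeZero d := ⟨by omega⟩
  set F := optimalFidelity γ with hF
  obtain ⟨c, hc, hw⟩ := werner_eq d hd hγ₁
  have hwT : (werner d γ)ᵀ = werner d γ := by
    rw [hw, transpose_smul, transpose_add, transpose_smul, swapOp_transpose, transpose_one]
  obtain ⟨e1, e2⟩ := trace_map_mul_eq_trace_extension hred (werner d γ)
    (F • (1 : Matrix (Fin 2 × Fin 2) (Fin 2 × Fin 2) ℂ) - maxEnt (Fin 2))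
  rw [hwT, hw] at e1 e2
  simp only [actOnFirst_sub, actOnFirst_smul, actOnFirst_one, actOnFirst_add, actOnSecond_sub,
    actOnSecond_smul, actOnSecond_one, actOnSecond_add, smul_kronecker, mul_smul_comm,
    trace_smul] at e1 e2
  have hM := trace_mul_nonneg (hτ.submatrix (regroup (Fin d) (Fin d) (Fin 2) (Fin 2)))
    (posSemidef_werner_witness (actOnFirst_isHermitian (swapOp_isHermitian d))
      (actOnSecond_isHermitian (swapOp_isHermitian d)) (actOnFirst_swapOp_mul_self d)
      (actOnSecond_swapOp_mul_self d) (actOn_swapOp_braid d)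
      (actOnFirst_isHermitian (maxEnt_isHermitian (Fin 2)))
      (actOnSecond_isHermitian (maxEnt_isHermitian (Fin 2)))
      maxEnt_relations.1.1 maxEnt_relations.1.2 maxEnt_relations.2.1 maxEnt_relations.2.2
      hγ₁ hγ₂ (half_lt_optimalFidelity hγ₁ hγ₂) (optimalFidelity_equation hγ₁ hγ₂))
  rw [mul_add, trace_add] at hM
  have hnum : 0 ≤ ((Λ (werner d γ)) *
      (F • (1 : Matrix (Fin 2 × Fin 2) (Fin 2 × Fin 2) ℂ) - maxEnt (Fin 2))).trace := by
    rw [← hw] at e1 e2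
    have hk : (0 : ℂ) ≤ (Fintype.card (Fin d) : ℂ) * Fintype.card (Fin d) := by
      exact_mod_cast Nat.zero_le _
    have h2 := smul_nonneg hc.le (mul_nonneg hk hM)
    rw [← hF, mul_add, smul_add] at h2
    -- Both summands are the same trace, one for each copy of Bob; halving leaves one of them.
    erw [← e1, ← e2] at h2
    have := smul_nonneg (show (0 : ℝ) ≤ 2⁻¹ by norm_num) h2
    rwa [← two_smul ℝ, smul_smul, inv_mul_cancel₀ two_ne_zero, one_smul] at this
  have hden : 0 ≤ (Λ (werner d γ)).trace :=
    (map_posSemidef Λ (werner_posSemidef d hd hγ₁ hγ₂)).trace_nonneg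
  rw [mul_sub, trace_sub, mul_smul_comm, mul_one, trace_smul] at hnum
  rw [fidelity]
  obtain ⟨hden1, hden2⟩ := Complex.nonneg_iff.mp hden
  obtain ⟨r, hr⟩ : ∃ r : ℝ, (Λ (werner d γ)).trace = r := ⟨_, Complex.ext rfl hden2.symm⟩
  rw [hr] at hden1 hnum h0 ⊢
  have hr0 : 0 < r := lt_of_le_of_ne (by simpa using hden1) (by rintro rfl; simp at h0)
  rw [Complex.div_ofReal_re, div_le_iff₀ hr0]
  simpa using (Complex.nonneg_iff.mp hnum).1

/-! ### Completely positive maps from Kraus operators. -/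

section Kraus

lemma cstarMatrix_sum_apply {m n ι A : Type*} [AddCommMonoid A] (s : Finset ι)
    (f : ι → CStarMatrix m n A) (i : m) (j : n) : (∑ x ∈ s, f x) i j = ∑ x ∈ s, f x i j :=
  Matrix.sum_apply i j s f

lemma cstarMatrix_rankOne_nonneg {A : Type*} [CStarAlgebra A] [PartialOrder A] [StarOrderedRing A]
    {k : ℕ} (v : Fin k → A) :
    0 ≤ CStarMatrix.ofMatrix (Matrix.of fun i j => star (v i) * v j) := by
  cases k with
  | zero => exact le_of_eq (by ext i; exact i.elim0)
  | succ k =>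
    have : CStarMatrix.ofMatrix (Matrix.of fun i j => star (v i) * v j) =
        star (CStarMatrix.ofMatrix (Matrix.of fun (i j : Fin (k + 1)) => if i = 0 then v j else 0)) *
          CStarMatrix.ofMatrix (Matrix.of fun (i j : Fin (k + 1)) => if i = 0 then v j else 0) := by
      ext i j : 2
      simp [CStarMatrix.mul_apply, CStarMatrix.star_apply]
    rw [this]
    exact star_mul_self_nonneg _

lemma exists_eq_star_mul_self {A : Type*} [CStarAlgebra A] [PartialOrder A] [StarOrderedRing A]
    {x : A} (hx : 0 ≤ x) : ∃ y, x = star y * y :=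
  CStarAlgebra.nonneg_iff_eq_star_mul_self.mp hx

variable {m n ι : Type*} [Fintype m] [Fintype n] [Fintype ι] [DecidableEq m] [DecidableEq n]

/-- The completely positive map with the given Kraus operators. -/
def krausMap [Nonempty n] (K : ι → Matrix n m ℂ) : Matrix m m ℂ →CP Matrix n n ℂ where
  toFun X := ∑ g, K g * X * (K g)ᴴ
  map_add' X Y := by simp only [Matrix.mul_add, Matrix.add_mul, Finset.sum_add_distrib]
  map_smul' c X := by simp [Finset.smul_sum]
  map_cstarMatrix_nonneg' k M hM := by
    obtain ⟨N, rfl⟩ := exists_eq_star_mul_self hM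
    -- `N l j * (K g)ᴴ` is rectangular, so its rows are treated separately, each stored as one row
    -- of a square matrix in the target algebra.
    let v (g : ι) (l : Fin k) (r : m) (j : Fin k) : Matrix n n ℂ :=
      Matrix.of fun p q => if p = Classical.arbitrary n then (N l j * (K g)ᴴ) r q else 0
    have key : (star N * N).map (fun X => ∑ g, K g * X * (K g)ᴴ) =
        ∑ g, ∑ l, ∑ r, CStarMatrix.ofMatrix (Matrix.of fun i j => star (v g l r i) * v g l r j) := by
      ext i j : 2
      simp only [CStarMatrix.map_apply, cstarMatrix_sum_apply]
      refine congrFun (congrFun ?_ _) _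
      refine Finset.sum_congr rfl fun g _ => ?_
      rw [CStarMatrix.mul_apply, Matrix.mul_sum, Matrix.sum_mul]
      refine Finset.sum_congr rfl fun l _ => ?_
      have : K g * ((star N) i l * N l j) * (K g)ᴴ = (N l i * (K g)ᴴ)ᴴ * (N l j * (K g)ᴴ) := by
        simp [CStarMatrix.star_apply, Matrix.mul_assoc, star_eq_conjTranspose]
      rw [this]
      ext p q
      simp [v, Matrix.sum_apply, Matrix.mul_apply, star_eq_conjTranspose, mul_comm (K g p _)]
    change 0 ≤ (star N * N).map (fun X => ∑ g, K g * X * (K g)ᴴ)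
    rw [key]
    exact Finset.sum_nonneg fun g _ => Finset.sum_nonneg fun l _ => Finset.sum_nonneg fun r _ =>
      cstarMatrix_rankOne_nonneg _

lemma krausMap_apply [Nonempty n] (K : ι → Matrix n m ℂ) (X : Matrix m m ℂ) :
    krausMap K X = ∑ g, K g * X * (K g)ᴴ := rfl

end Kraus

/-! ### Extendible maps from antisymmetric pure states. -/

section PureExtension

variable {A B a b : Type*} [Fintype A] [Fintype B] [Fintype a] [Fintype b]
  [DecidableEq A] [DecidableEq B] [DecidableEq a] [DecidableEq b]

/-- The completely positive map whose Choi operator is the partial trace of the pure state `ψ`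
over the second copy of Bob's system. -/
noncomputable def pureMap [Nonempty (a × b)] (ψ : (A × B × B) × (a × b × b) → ℂ) :
    Matrix (A × B) (A × B) ℂ →CP Matrix (a × b) (a × b) ℂ :=
  krausMap fun g : B × b => Matrix.of fun p x =>
    ((Real.sqrt (Fintype.card A * Fintype.card B) : ℝ) : ℂ) *
      ψ ((x.1, x.2, g.1), (p.1, p.2, g.2))

lemma choi_pureMap [Nonempty A] [Nonempty B] [Nonempty (a × b)]
    (ψ : (A × B × B) × (a × b × b) → ℂ) :
    choi (pureMap ψ : Matrix (A × B) (A × B) ℂ →ₗ[ℂ] Matrix (a × b) (a × b) ℂ) =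
      traceSecond (vecMulVec ψ (star ψ)) := by
  ext u v
  rw [choi_apply]
  change _ * krausMap _ (Matrix.single u.1 v.1 1) u.2 v.2 = _
  have hc : ((Fintype.card A : ℂ) * Fintype.card B) ≠ 0 := by simp [Fintype.card_ne_zero]
  have hs : ((Real.sqrt (Fintype.card A * Fintype.card B) : ℝ) : ℂ) *
      ((Real.sqrt (Fintype.card A * Fintype.card B) : ℝ) : ℂ) =
      (Fintype.card A : ℂ) * Fintype.card B := by
    rw [← Complex.ofReal_mul, Real.mul_self_sqrt (by positivity)]
    simp
  rw [inv_mul_eq_iff_eq_mul₀ hc, krausMap_apply, Matrix.sum_apply, traceSecond, of_apply,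
    Finset.mul_sum]
  refine Finset.sum_congr rfl fun g _ => ?_
  simp only [Matrix.mul_apply, Matrix.single_apply, of_apply, conjTranspose_apply, vecMulVec_apply,
    Pi.star_apply, ← hs, ite_and]
  simp
  ring

/-- The sign in `hψ` cancels in `|ψ⟩⟨ψ|`, which is therefore invariant under exchanging the Bobs. -/
lemma pureMap_extension [Nonempty A] [Nonempty B] [Nonempty (a × b)]
    {ψ : (A × B × B) × (a × b × b) → ℂ}
    (hψ : ∀ u, ψ (Prod.map (exchange A B) (exchange a b) u) = -ψ u) (i : Fin (1 + 1)) :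
    reduction i ((vecMulVec ψ (star ψ)).submatrix (regroup A B a b).symm (regroup A B a b).symm) =
      (choi (pureMap ψ : Matrix (A × B) (A × B) ℂ →ₗ[ℂ] Matrix (a × b) (a × b) ℂ)).submatrix
      (fun x : (A × a) × (B × b) => ((x.1.1, x.2.1), (x.1.2, x.2.2)))
      (fun x : (A × a) × (B × b) => ((x.1.1, x.2.1), (x.1.2, x.2.2))) := by
  rw [choi_pureMap]
  ext ⟨⟨x₁, x₂⟩, x₃, x₄⟩ ⟨⟨y₁, y₂⟩, y₃, y₄⟩
  have hsub : ((vecMulVec ψ (star ψ)).submatrix (regroup A B a b).symm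
      (regroup A B a b).symm).submatrix (regroup A B a b) (regroup A B a b) =
        vecMulVec ψ (star ψ) := by
    ext u v
    simp
  fin_cases i
  · refine (reduction_zero_eq _ ((x₁, x₃), (x₂, x₄)) ((y₁, y₃), (y₂, y₄))).trans ?_
    rw [hsub]
    rfl
  · refine (reduction_one_eq _ ((x₁, x₃), (x₂, x₄)) ((y₁, y₃), (y₂, y₄))).trans ?_
    rw [hsub]
    have : (vecMulVec ψ (star ψ)).submatrix (Prod.map (exchange A B) (exchange a b))
        (Prod.map (exchange A B) (exchange a b)) = vecMulVec ψ (star ψ) := by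
      ext u v
      simp only [submatrix_apply, vecMulVec_apply, Pi.star_apply, hψ]
      simp
    rw [this]
    rfl

lemma pureMap_isExtendibleMap [Nonempty A] [Nonempty B] [Nonempty (a × b)]
    {ψ : (A × B × B) × (a × b × b) → ℂ}
    (hψ : ∀ u, ψ (Prod.map (exchange A B) (exchange a b) u) = -ψ u) :
    IsExtendibleMap 1 (pureMap ψ) :=
  ⟨_, (posSemidef_vecMulVec_self_star ψ).submatrix _, pureMap_extension hψ⟩

lemma trace_pureMap_mul [Nonempty A] [Nonempty B] [Nonempty (a × b)]
    (ψ : (A × B × B) × (a × b × b) → ℂ)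
    (ρ : Matrix (A × B) (A × B) ℂ) (W : Matrix (a × b) (a × b) ℂ) :
    (pureMap ψ ρ * W).trace = ((Fintype.card A : ℂ) * Fintype.card B) *
      (star ψ ⬝ᵥ (actOnFirst ρᵀ ⊗ₖ actOnFirst W) *ᵥ ψ) := by
  refine (trace_map_mul (pureMap ψ : Matrix (A × B) (A × B) ℂ →ₗ[ℂ] Matrix (a × b) (a × b) ℂ)
    ρ W).trans ?_
  rw [choi_pureMap, ← trace_mul_kronecker_actOnFirst, vecMulVec_mul, trace_vecMulVec,
    dotProduct_comm, dotProduct_mulVec]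

end PureExtension

lemma prod_dotProduct_kronecker_mulVec {m n : Type*} [Fintype m] [Fintype n]
    (U : Matrix m m ℂ) (W : Matrix n n ℂ) (f f' : m → ℂ) (g g' : n → ℂ) :
    (fun u : m × n => f u.1 * g u.2) ⬝ᵥ (U ⊗ₖ W) *ᵥ (fun u : m × n => f' u.1 * g' u.2) =
      (f ⬝ᵥ U *ᵥ f') * (g ⬝ᵥ W *ᵥ g') := by
  simp only [dotProduct, mulVec, Fintype.sum_prod_type, kroneckerMap_apply]
  rw [Finset.sum_mul_sum]
  refine Finset.sum_congr rfl fun i _ => Finset.sum_congr rfl fun j _ => ?_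
  rw [mul_mul_mul_comm, Finset.sum_mul_sum]
  congr 1
  exact Finset.sum_congr rfl fun k _ => Finset.sum_congr rfl fun l _ => by ring

/-! ### Vectors for the optimal state. -/

section Triple

variable {d : ℕ} (i j : Fin d)

/-- `|iij⟩ - |iji⟩`. -/
def antiTriple : Fin d × Fin d × Fin d → ℂ :=
  Pi.single (i, i, j) 1 - Pi.single (i, j, i) 1

/-- `2|jii⟩ - |iji⟩ - |iij⟩`. -/
def symTriple : Fin d × Fin d × Fin d → ℂ :=
  (2 : ℂ) • Pi.single (j, i, i) 1 - Pi.single (i, j, i) 1 - Pi.single (i, i, j) 1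

variable {i j}

lemma triple_dotProduct (h : i ≠ j) :
    antiTriple i j ⬝ᵥ antiTriple i j = 2 ∧ antiTriple i j ⬝ᵥ symTriple i j = 0 ∧
      symTriple i j ⬝ᵥ antiTriple i j = 0 ∧ symTriple i j ⬝ᵥ symTriple i j = 6 := by
  refine ⟨?_, ?_, ?_, ?_⟩ <;>
  simp [antiTriple, symTriple, h, h.symm] <;> norm_num

/-- The two vectors are orthogonal to `|iij⟩ + |iji⟩ + |jii⟩` and span a two-dimensional irreducible
representation of `S₃`. -/
lemma triple_dotProduct_swap (h : i ≠ j) :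
    antiTriple i j ⬝ᵥ actOnFirst (swapOp d) *ᵥ antiTriple i j = 1 ∧
      antiTriple i j ⬝ᵥ actOnFirst (swapOp d) *ᵥ symTriple i j = -3 ∧
      symTriple i j ⬝ᵥ actOnFirst (swapOp d) *ᵥ antiTriple i j = -3 ∧
      symTriple i j ⬝ᵥ actOnFirst (swapOp d) *ᵥ symTriple i j = -3 := by
  simp only [actOnFirst_swapOp, permMatrix_mulVec]
  refine ⟨?_, ?_, ?_, ?_⟩ <;>
  simp [antiTriple, symTriple, sub_dotProduct, h, h.symm, exchangeFirst] <;>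
  norm_num

lemma antiTriple_exchange (p : Fin d × Fin d × Fin d) :
    antiTriple i j (exchange _ _ p) = -antiTriple i j p := by
  obtain ⟨x, y, z⟩ := p
  simp only [antiTriple, exchange, Equiv.coe_fn_mk, Pi.sub_apply, Pi.single_apply, Prod.mk.injEq,
    neg_sub, and_comm (a := z = _)]

lemma symTriple_exchange (p : Fin d × Fin d × Fin d) :
    symTriple i j (exchange _ _ p) = symTriple i j p := by
  obtain ⟨x, y, z⟩ := p
  simp only [symTriple, exchange, Equiv.coe_fn_mk, Pi.sub_apply, Pi.smul_apply, Pi.single_apply,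
    Prod.mk.injEq, and_comm (a := z = _)]
  ring

lemma star_antiTriple : star (antiTriple i j) = antiTriple i j := by
  ext p
  simp only [antiTriple, Pi.star_apply, Pi.sub_apply, Pi.single_apply]
  split_ifs <;> simp

lemma star_symTriple : star (symTriple i j) = symTriple i j := by
  ext p
  simp only [symTriple, Pi.star_apply, Pi.sub_apply, Pi.smul_apply, Pi.single_apply]
  split_ifs <;> simp

end Triple

section QubitTriple

/-- `2|000⟩ + |110⟩ + |101⟩`. -/
def symQubits : Fin 2 × Fin 2 × Fin 2 → ℂ :=
  (2 : ℂ) • Pi.single (0, 0, 0) 1 + Pi.single (1, 1, 0) 1 + Pi.single (1, 0, 1) 1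

/-- `|110⟩ - |101⟩`. -/
def antiQubits : Fin 2 × Fin 2 × Fin 2 → ℂ :=
  Pi.single (1, 1, 0) 1 - Pi.single (1, 0, 1) 1

lemma qubits_dotProduct :
    symQubits ⬝ᵥ symQubits = 6 ∧ symQubits ⬝ᵥ antiQubits = 0 ∧
      antiQubits ⬝ᵥ symQubits = 0 ∧ antiQubits ⬝ᵥ antiQubits = 2 := by
  refine ⟨?_, ?_, ?_, ?_⟩ <;>
  simp [symQubits, antiQubits] <;> norm_num

/-- `symQubits` and `antiQubits` are the sum and difference of `|000⟩ + |110⟩` and `|000⟩ + |101⟩`,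
which lie in the ranges of the two Bell projections. -/
lemma qubits_dotProduct_maxEnt :
    symQubits ⬝ᵥ actOnFirst (maxEnt (Fin 2)) *ᵥ symQubits = 9 / 2 ∧
      symQubits ⬝ᵥ actOnFirst (maxEnt (Fin 2)) *ᵥ antiQubits = 3 / 2 ∧
      antiQubits ⬝ᵥ actOnFirst (maxEnt (Fin 2)) *ᵥ symQubits = 3 / 2 ∧
      antiQubits ⬝ᵥ actOnFirst (maxEnt (Fin 2)) *ᵥ antiQubits = 1 / 2 := by
  refine ⟨?_, ?_, ?_, ?_⟩ <;>
  simp [symQubits, antiQubits, sub_dotProduct, add_dotProduct, mulVec_add, mulVec_sub,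
    mulVec_smul, actOnFirst, maxEnt_apply] <;> norm_num

lemma symQubits_exchange (p : Fin 2 × Fin 2 × Fin 2) :
    symQubits (exchange _ _ p) = symQubits p := by
  obtain ⟨x, y, z⟩ := p
  simp only [symQubits, exchange, Equiv.coe_fn_mk, Pi.add_apply, Pi.smul_apply, Pi.single_apply,
    Prod.mk.injEq, and_comm (a := z = _)]
  ring

lemma antiQubits_exchange (p : Fin 2 × Fin 2 × Fin 2) :
    antiQubits (exchange _ _ p) = -antiQubits p := by
  obtain ⟨x, y, z⟩ := p
  simp only [antiQubits, exchange, Equiv.coe_fn_mk, Pi.sub_apply, Pi.single_apply, Prod.mk.injEq,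
    neg_sub, and_comm (a := z = _)]

lemma star_symQubits : star symQubits = symQubits := by
  ext p
  simp only [symQubits, Pi.star_apply, Pi.add_apply, Pi.smul_apply, Pi.single_apply]
  split_ifs <;> simp

lemma star_antiQubits : star antiQubits = antiQubits := by
  ext p
  simp only [antiQubits, Pi.star_apply, Pi.sub_apply, Pi.single_apply]
  split_ifs <;> simp

end QubitTriple

/-- The vector `x (|iij⟩ - |iji⟩) ⊗ (2|000⟩ + |110⟩ + |101⟩) +
y (2|jii⟩ - |iji⟩ - |iij⟩) ⊗ (|110⟩ - |101⟩)`. -/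
def oddVector {d : ℕ} (i j : Fin d) (x y : ℝ) :
    (Fin d × Fin d × Fin d) × (Fin 2 × Fin 2 × Fin 2) → ℂ :=
  (x : ℂ) • (fun u => antiTriple i j u.1 * symQubits u.2) +
    (y : ℂ) • (fun u => symTriple i j u.1 * antiQubits u.2)

section OddVector

variable {d : ℕ} {i j : Fin d} (x y : ℝ)

lemma oddVector_exchange (u : (Fin d × Fin d × Fin d) × (Fin 2 × Fin 2 × Fin 2)) :
    oddVector i j x y (Prod.map (exchange _ _) (exchange _ _) u) = -oddVector i j x y u := by
  simp only [oddVector, Pi.add_apply, Pi.smul_apply, Prod.map_fst, Prod.map_snd,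
    antiTriple_exchange, symTriple_exchange, symQubits_exchange, antiQubits_exchange, smul_eq_mul]
  ring

lemma star_oddVector : star (oddVector i j x y) = oddVector i j x y := by
  ext u
  have h1 := congrFun (star_antiTriple (i := i) (j := j)) u.1
  have h2 := congrFun (star_symTriple (i := i) (j := j)) u.1
  have h3 := congrFun star_symQubits u.2
  have h4 := congrFun star_antiQubits u.2
  simp only [Pi.star_apply] at h1 h2 h3 h4
  simp only [oddVector, Pi.star_apply, Pi.add_apply, Pi.smul_apply, star_add, star_smul, star_mul',
    h1, h2, h3, h4]
  simp

lemma oddVector_dotProduct (U : Matrix (Fin d × Fin d × Fin d) (Fin d × Fin d × Fin d) ℂ)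
    (W : Matrix (Fin 2 × Fin 2 × Fin 2) (Fin 2 × Fin 2 × Fin 2) ℂ) :
    star (oddVector i j x y) ⬝ᵥ (U ⊗ₖ W) *ᵥ oddVector i j x y =
      x * x * ((antiTriple i j ⬝ᵥ U *ᵥ antiTriple i j) * (symQubits ⬝ᵥ W *ᵥ symQubits)) +
      x * y * ((antiTriple i j ⬝ᵥ U *ᵥ symTriple i j) * (symQubits ⬝ᵥ W *ᵥ antiQubits)) +
      y * x * ((symTriple i j ⬝ᵥ U *ᵥ antiTriple i j) * (antiQubits ⬝ᵥ W *ᵥ symQubits)) +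
      y * y * ((symTriple i j ⬝ᵥ U *ᵥ symTriple i j) * (antiQubits ⬝ᵥ W *ᵥ antiQubits)) := by
  rw [star_oddVector]
  simp only [oddVector, mulVec_add, mulVec_smul, add_dotProduct, dotProduct_add, smul_dotProduct,
    dotProduct_smul, prod_dotProduct_kronecker_mulVec, smul_eq_mul]
  ring

end OddVector

/-! ### Attainment and conclusion. -/

theorem optimalFidelity_mem (d : ℕ) (hd : 2 ≤ d) {γ : ℝ} (hγ₁ : -1 ≤ γ) (hγ₂ : γ ≤ 1) :
    optimalFidelity γ ∈ achievableFidelities 1 (werner d γ) := by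
  have : NeZero d := ⟨by omega⟩
  obtain ⟨c, hc, hw⟩ := werner_eq d hd hγ₁
  have hwT : (1 + γ • swapOp d)ᵀ = 1 + γ • swapOp d := by
    rw [transpose_add, transpose_smul, swapOp_transpose, transpose_one]
  set F := optimalFidelity γ with hF
  have hF2 : 1 / 2 < F := half_lt_optimalFidelity hγ₁ hγ₂
  have hFe : (4 - γ ^ 2) * (2 * F - 1) ^ 2 = 1 + 2 * γ ^ 2 := optimalFidelity_equation hγ₁ hγ₂
  let i : Fin d := ⟨0, by omega⟩
  let j : Fin d := ⟨1, by omega⟩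
  have hij : i ≠ j := by simp [i, j]
  -- With numerator and denominator as quadratic forms `N`, `D` in `(x, y)`, this pair solves the
  -- second row of `(N - F D)(x, y) = 0`. The first row is then a consequence of `hFe`.
  obtain ⟨x, hx⟩ : ∃ x, x = (2 - γ) * (F - 1 / 4) := ⟨_, rfl⟩
  obtain ⟨y, hy⟩ : ∃ y, y = -(3 / 4) * γ := ⟨_, rfl⟩
  let ψ := oddVector i j x y
  obtain ⟨a1, a2, a3, a4⟩ := triple_dotProduct hij
  obtain ⟨b1, b2, b3, b4⟩ := triple_dotProduct_swap hij
  obtain ⟨c1, c2, c3, c4⟩ := qubits_dotProduct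
  obtain ⟨e1, e2, e3, e4⟩ := qubits_dotProduct_maxEnt
  have htr (W : Matrix (Fin 2 × Fin 2) (Fin 2 × Fin 2) ℂ) : (pureMap ψ (werner d γ) * W).trace =
      c * d ^ 2 * (star ψ ⬝ᵥ ((1 + γ • actOnFirst (swapOp d)) ⊗ₖ actOnFirst W) *ᵥ ψ) := by
    rw [trace_pureMap_mul, hw, transpose_smul, hwT, actOnFirst_smul, actOnFirst_add,
      actOnFirst_one, actOnFirst_smul, smul_kronecker, smul_mulVec, dotProduct_smul,
      Complex.real_smul, Fintype.card_fin]
    ring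
  have hden : (pureMap ψ (werner d γ)).trace =
      ((c * d ^ 2 * (x ^ 2 * (6 * (2 + γ)) + y ^ 2 * (6 * (2 - γ))) : ℝ) : ℂ) := by
    rw [← mul_one (pureMap ψ (werner d γ)), htr, oddVector_dotProduct, actOnFirst_one]
    simp only [add_mulVec, smul_mulVec, one_mulVec, dotProduct_add, dotProduct_smul, a1, a2, a3,
      a4, b1, b2, b3, b4, c1, c2, c3, c4, Complex.real_smul]
    push_cast
    ring
  have hnum : (pureMap ψ (werner d γ) * maxEnt (Fin 2)).trace =
      ((c * d ^ 2 * (x ^ 2 * (9 / 2 * (2 + γ)) - 9 * γ * x * y +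
        y ^ 2 * (1 / 2 * (6 - 3 * γ))) : ℝ) : ℂ) := by
    rw [htr, oddVector_dotProduct]
    simp only [add_mulVec, smul_mulVec, one_mulVec, dotProduct_add, dotProduct_smul, a1, a2, a3,
      a4, b1, b2, b3, b4, e1, e2, e3, e4, Complex.real_smul]
    push_cast
    ring
  have hd0 : (0 : ℝ) < d := by exact_mod_cast (by omega : 0 < d)
  have hx0 : 0 < x := by
    rw [hx]
    exact mul_pos (by linarith) (by linarith)
  have hpos : 0 < c * d ^ 2 * (x ^ 2 * (6 * (2 + γ)) + y ^ 2 * (6 * (2 - γ))) := by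
    have h1 : 0 < x ^ 2 * (6 * (2 + γ)) := mul_pos (by positivity) (by linarith)
    have h2 : 0 ≤ y ^ 2 * (6 * (2 - γ)) := mul_nonneg (by positivity) (by linarith)
    exact mul_pos (by positivity) (by linarith)
  refine ⟨pureMap ψ, pureMap_isExtendibleMap (oddVector_exchange x y), ?_, ?_⟩
  · rw [hden]
    exact_mod_cast hpos.ne'
  · rw [fidelity, hnum, hden, ← Complex.ofReal_div, Complex.ofReal_re, eq_div_iff hpos.ne', hx, hy]
    linear_combination (3 / 2 * c * d ^ 2 * (2 - γ) * (F - 1 / 4)) * hFe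

end ExtendibleMaps

theorem proposition5 (d : ℕ) (hd : 2 ≤ d) (γ : ℝ) (hγ₁ : -1 ≤ γ) (hγ₂ : γ ≤ 1) :
    IsGreatest (ExtendibleMaps.achievableFidelities 1 (ExtendibleMaps.werner d γ))
      (1 / 2 + 1 / 2 * Real.sqrt ((1 + 2 * γ ^ 2) / (4 - γ ^ 2))) := by
  refine ⟨ExtendibleMaps.optimalFidelity_mem d hd hγ₁ hγ₂, ?_⟩
  rintro _ ⟨Λ, hΛ, h0, rfl⟩
  exact ExtendibleMaps.fidelity_le_optimalFidelity d hd hγ₁ hγ₂ hΛ h0
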